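/- A \emph{diversity-seeking jump game} consists of a finite set $R$ of strategic agents, a finite set $S$ of stubborn agents with $|R\cup S| = n\ge 2$, a partition of $R\cup S$ into $k\ge 2$ nonempty types, a finite undirected graph $G=(V,E)$ with $|V|>n$ (the topology), and an injective map $\lambda:S\to V$. An \emph{assignment} $C$ is an injective map placing each agent on a node of $G$ and agreeing with $\lambda$ on $S$. The \emph{utility} $u_A(C)$ of an agent $A$ placed on the node $v$ is the number of neighbors of $v$ occupied by agents of a type different from that of $A$, divided by the total number of occupied neighbors of $v$, and is $0$ if $v$ has no occupied neighbor. An assignment $C$ is a \emph{pure Nash equilibrium} if $u_A(C)\ge u_A(C')$ for every strategic agent $A$ and every assignment $C'$ obtained from $C$ by moving $A$ to a node that is empty in $C$ while all other agents stay where they are. Theorem. For every $k\ge 2$, every diversity-seeking jump game in which $G$ is a tree, there are no stubborn agents ($S=\varnothing$), and there is more than one empty node ($|V|>|R|+1$) has a pure Nash equilibrium assignment. -/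

import Mathlib

/-- An instance `(R, S, 𝒯, G, loc)` of the diversity-seeking jump game: `R` is the set of strategic
agents, `S` the set of stubborn agents (so the agents are `R ⊕ S`), `V` the set of nodes of the
topology, and the agents are partitioned into `k` types, the type of an agent being an element of
`Fin k`. -/
structure JumpGame (R S V : Type*) [Fintype R] [Fintype S] [Fintype V] (k : ℕ) where
  /-- the topology -/
  G : SimpleGraph V
  /-- the type of each agent -/
  type : R ⊕ S → Fin k
  /-- the fixed locations of the stubborn agents -/
  loc : S ↪ V
  /-- there are at least two types -/
  two_le_types : 2 ≤ k
  /-- the classes of the partition into types are nonempty -/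
  type_surjective : Function.Surjective type
  /-- there are at least two agents -/
  two_le_agents : 2 ≤ Fintype.card R + Fintype.card S
  /-- there are more nodes than agents -/
  agents_lt_nodes : Fintype.card R + Fintype.card S < Fintype.card V

namespace JumpGame

variable {R S V : Type*} [Fintype R] [Fintype S] [Fintype V] {k : ℕ}

/-- An assignment: an injective mapping of the agents to the nodes that respects the fixed
locations of the stubborn agents. -/
structure Assignment (I : JumpGame R S V k) where
  /-- the node that each agent occupies -/
  node : R ⊕ S → V
  injective : Function.Injective node
  stubborn : ∀ s : S, node (Sum.inr s) = I.loc s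

/-- The number of neighbors of the node `v` that are occupied by agents of type `t`. -/
noncomputable def numType (I : JumpGame R S V k) (C : I.Assignment) (t : Fin k) (v : V) : ℕ :=
  Set.ncard {w : V | I.G.Adj v w ∧ ∃ a : R ⊕ S, C.node a = w ∧ I.type a = t}

/-- The total number of agents in the neighborhood of the node `v`. -/
noncomputable def numAgents (I : JumpGame R S V k) (C : I.Assignment) (v : V) : ℕ :=
  ∑ t : Fin k, I.numType C t v

/-- The utility of an agent: the fraction of agents of a different type among the agents in its
neighborhood. It is `0` for an agent with no neighboring agents, because `x / 0 = 0`. -/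
noncomputable def utility (I : JumpGame R S V k) (C : I.Assignment) (a : R ⊕ S) : ℝ :=
  ((∑ t ∈ Finset.univ.filter (fun t : Fin k => t ≠ I.type a), I.numType C t (C.node a) : ℕ) : ℝ) /
    (I.numAgents C (C.node a) : ℝ)

/-- `C'` arises from `C` by a jump of the strategic agent `r` to a node that is empty in `C`, all
other agents staying where they are. -/
def IsJump (I : JumpGame R S V k) (C C' : I.Assignment) (r : R) : Prop :=
  (∀ a : R ⊕ S, C.node a ≠ C'.node (Sum.inl r)) ∧
    ∀ a : R ⊕ S, a ≠ Sum.inl r → C'.node a = C.node a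

/-- `C` is a pure Nash equilibrium: no strategic agent can increase its utility by jumping to an
empty node. -/
def IsEquilibrium (I : JumpGame R S V k) (C : I.Assignment) : Prop :=
  ∀ (r : R) (C' : I.Assignment), I.IsJump C C' r →
    I.utility C' (Sum.inl r) ≤ I.utility C (Sum.inl r)

end JumpGame

/-!
Let `n` be the number of agents and `t` a type with the largest number of agents. The agents fill
a set `T` of `n` nodes that is partitioned into `m` stars (`SimpleGraph.StarCover`). The stars are
obtained by exhausting the tree: among the nodes not yet used, one has at most one unused
neighbour. If it has none, it becomes a leaf of an earlier star, and otherwise it forms a new star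
with that neighbour as the center. In this way leaves are adjacent to centers only, all neighbours
of leaves belong to the cover, and a leaf is adjacent to centers of its own and of earlier stars
only. As one step uses up one or two nodes, the construction may stop at `n - 1` nodes instead
of `n` (`SimpleGraph.IsTree.exists_starCover`).

* If type `t` has at least `m` agents, these are placed on all centers and the remaining agents
  anywhere on the leaves. Agents of other types then sit on leaves, and all their neighbours are
  occupied by agents of type `t`. They have utility `1`, and no empty node has a neighbour of a type
  other than `t`, so no agent of type `t` gains by a jump
  (`JumpGame.isEquilibrium_of_neighbors`).
* If no type has more than `m` agents, the nodes of `T` can be enumerated so that adjacent nodes are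
  at least `m` places apart (`SimpleGraph.StarCover.exists_spread_equiv`). Listing the agents type by
  type along this enumeration separates agents of the same type, because each type occupies at most
  `m` consecutive places. Every node of a star cover has a neighbour in it, so all agents have
  utility `1`.

If the cover has only `n - 1` nodes, one more node is added: as a further center if type `t` has
more than `m` agents, and otherwise as a further leaf, namely a node adjacent to the cover, which
exists by connectedness.
-/

namespace SimpleGraph

variable {V : Type*} {G : SimpleGraph V}

/-! ### Two facts on acyclic and preconnected graphs -/

/-- Every nonempty finite set `W` of vertices of an acyclic graph has a member with at most one
neighbour in `W`: take the end of a longest path inside `W`. -/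
lemma IsAcyclic.exists_mem_subsingleton_neighbors (hG : G.IsAcyclic) {W : Set V} (hW : W.Finite)
    (hne : W.Nonempty) :
    ∃ x ∈ W, ∀ y ∈ W, ∀ z ∈ W, G.Adj x y → G.Adj x z → y = z := by
  have : Finite W := hW
  have : Nonempty W := hne.to_subtype
  have hH : (G.induce W).IsAcyclic := hG.induce W
  obtain ⟨u, v, p, hp, hmax⟩ := Walk.exists_isPath_forall_isPath_length_le_length (G.induce W)
  have key : ∀ w, (G.induce W).Adj v w → w = p.penultimate := by
    intro w hadj
    apply hH.eq_penultimate_of_adj_end hp hadj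
    by_contra hw
    have := hmax _ _ _ (hp.concat hw hadj)
    simp at this
  refine ⟨v, v.2, fun y hy z hz hay haz => ?_⟩
  have h1 := key ⟨y, hy⟩ (by simpa using hay)
  have h2 := key ⟨z, hz⟩ (by simpa using haz)
  exact congrArg Subtype.val (h1.trans h2.symm)

/-- In a preconnected graph, some edge leaves any nonempty proper set of vertices. -/
lemma Preconnected.exists_adj_mem_notMem (hG : G.Preconnected) {A : Set V} {a b : V}
    (ha : a ∈ A) (hb : b ∉ A) : ∃ x ∈ A, ∃ y ∉ A, G.Adj x y := by
  obtain ⟨p⟩ := hG a b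
  obtain ⟨d, -, h1, h2⟩ := p.exists_boundary_dart A ha hb
  exact ⟨d.fst, h1, d.snd, h2, d.adj⟩

/-! ### Star covers -/

/-- A decomposition of the vertex set `T` into `m` stars, numbered by `idx`. The set `C` contains
exactly one center for each star, each star has at least one leaf, and no two leaves are adjacent.
A leaf is joined to the center of its own star, and otherwise only to centers of stars with
smaller numbers. -/
structure StarCover (G : SimpleGraph V) (T C : Finset V) (m : ℕ) (idx : V → ℕ) : Prop where
  subset : C ⊆ T
  lt : ∀ c ∈ C, idx c < m
  inj : ∀ c ∈ C, ∀ d ∈ C, idx c = idx d → c = d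
  exists_center : ∀ j < m, ∃ c ∈ C, idx c = j
  exists_leaf : ∀ j < m, ∃ x ∈ T, x ∉ C ∧ idx x = j
  home : ∀ x ∈ T, x ∉ C → ∃ c ∈ C, G.Adj x c ∧ idx c = idx x
  order : ∀ x ∈ T, x ∉ C → ∀ y ∈ T, G.Adj x y → y ∈ C ∧ idx y ≤ idx x

/-- All neighbours of the leaves (the members of `T` outside `C`) lie in `T`. -/
def LeafClosed (G : SimpleGraph V) (T C : Finset V) : Prop :=
  ∀ x ∈ T, x ∉ C → ∀ y, G.Adj x y → y ∈ T

namespace StarCover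

variable {T C : Finset V} {m : ℕ} {idx : V → ℕ}

lemma empty : StarCover G ∅ ∅ 0 idx := by
  constructor <;> simp

lemma card_centers (h : StarCover G T C m idx) : C.card = m := by
  have : C.image idx = Finset.range m := by
    ext j
    simp only [Finset.mem_image, Finset.mem_range]
    exact ⟨fun ⟨c, hc, hj⟩ => hj ▸ h.lt c hc, fun hj => h.exists_center j hj⟩
  rw [← Finset.card_range m, ← this, Finset.card_image_of_injOn]
  exact fun c hc d hd hcd => h.inj c hc d hd hcd

lemma idx_lt (h : StarCover G T C m idx) {x : V} (hx : x ∈ T) : idx x < m := by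
  by_cases hc : x ∈ C
  · exact h.lt x hc
  · obtain ⟨c, hc, -, e⟩ := h.home x hx hc
    exact e ▸ h.lt c hc

/-- Every vertex of a star cover has a neighbour in it. -/
lemma exists_adj (h : StarCover G T C m idx) {x : V} (hx : x ∈ T) : ∃ y ∈ T, G.Adj x y := by
  by_cases hc : x ∈ C
  · obtain ⟨y, hy, hyC, e⟩ := h.exists_leaf _ (h.lt x hc)
    obtain ⟨c, hcC, hadj, e'⟩ := h.home y hy hyC
    obtain rfl := h.inj c hcC x hc (e'.trans e)
    exact ⟨y, hy, hadj.symm⟩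
  · obtain ⟨c, hcC, hadj, -⟩ := h.home x hx hc
    exact ⟨c, h.subset hcC, hadj⟩

/-- A vertex whose neighbours in `T` are centers can be added as a leaf, namely to the last of the
stars of these centers. -/
lemma insert_leaf [DecidableEq V] (h : StarCover G T C m idx) {v : V} (hv : v ∉ T)
    (hC : ∀ y ∈ T, G.Adj v y → y ∈ C) (hne : ∃ y ∈ T, G.Adj v y) :
    ∃ idx', StarCover G (insert v T) C m idx' := by
  classical
  obtain ⟨y, hy, hvy⟩ := hne
  obtain ⟨c, hc, hmax⟩ := (T.filter (G.Adj v)).exists_max_image idx ⟨y, by simp [hy, hvy]⟩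
  simp only [Finset.mem_filter, and_imp] at hc hmax
  obtain ⟨hcT, hvc⟩ := hc
  have hcC := hC c hcT hvc
  have hne : ∀ x ∈ T, Function.update idx v (idx c) x = idx x := fun x hx =>
    Function.update_of_ne (by rintro rfl; exact hv hx) _ _
  have hvv : Function.update idx v (idx c) v = idx c := by simp
  have hneC : ∀ x ∈ C, Function.update idx v (idx c) x = idx x := fun x hx => hne x (h.subset hx)
  generalize Function.update idx v (idx c) = f at *
  refine ⟨f, ?_, ?_, ?_, ?_, ?_, ?_, ?_⟩
  · exact h.subset.trans (Finset.subset_insert _ _)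
  · intro d hd
    rw [hneC d hd]; exact h.lt d hd
  · intro d hd e he
    rw [hneC d hd, hneC e he]; exact h.inj d hd e he
  · intro j hj
    obtain ⟨d, hd, e⟩ := h.exists_center j hj
    exact ⟨d, hd, (hneC d hd).trans e⟩
  · intro j hj
    obtain ⟨d, hd, hdC, e⟩ := h.exists_leaf j hj
    exact ⟨d, Finset.mem_insert_of_mem hd, hdC, (hne d hd).trans e⟩
  · intro x hx hxC
    rcases Finset.mem_insert.1 hx with rfl | hx
    · exact ⟨c, hcC, hvc, by rw [hvv, hneC c hcC]⟩
    · obtain ⟨d, hd, ha, e⟩ := h.home x hx hxC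
      exact ⟨d, hd, ha, by rw [hneC d hd, hne x hx, e]⟩
  · intro x hx hxC y hy ha
    rcases Finset.mem_insert.1 hx with rfl | hxT
    · rcases Finset.mem_insert.1 hy with rfl | hyT
      · exact absurd ha (G.irrefl)
      · exact ⟨hC y hyT ha, by rw [hvv, hne y hyT]; exact hmax y hyT ha⟩
    · rcases Finset.mem_insert.1 hy with rfl | hyT
      · exact absurd (hC x hxT ha.symm) hxC
      · rw [hne x hxT, hne y hyT]
        exact h.order x hxT hxC y hyT ha

/-- A vertex `p` together with a vertex `x` whose only neighbour outside `T` is `p` can be added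
as a new, last star. -/
lemma insert_star [DecidableEq V] (h : StarCover G T C m idx) (hcl : LeafClosed G T C) {x p : V}
    (hx : x ∉ T) (hp : p ∉ T) (hxp : G.Adj x p) (honly : ∀ y ∉ T, G.Adj x y → y = p) :
    LeafClosed G (insert x (insert p T)) (insert p C) ∧
    ∃ idx', StarCover G (insert x (insert p T)) (insert p C) (m + 1) idx' := by
  classical
  have hxp' : x ≠ p := hxp.ne
  have hxC : x ∉ C := fun hc => hx (h.subset hc)
  refine ⟨?_, ?_⟩
  · intro y hy hyC z hyz
    simp only [Finset.mem_insert, not_or] at hy hyC ⊢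
    rcases hy with rfl | rfl | hy
    · by_cases hz : z ∈ T
      · exact Or.inr (Or.inr hz)
      · exact Or.inr (Or.inl (honly z hz hyz))
    · exact absurd rfl hyC.1
    · exact Or.inr (Or.inr (hcl y hy hyC.2 z hyz))
  obtain ⟨f, hne, hfx, hfp⟩ : ∃ f : V → ℕ, (∀ y ∈ T, f y = idx y) ∧ f x = m ∧ f p = m :=
    ⟨fun y => if y ∈ T then idx y else m, fun y hy => if_pos hy, if_neg hx, if_neg hp⟩
  have hneC : ∀ y ∈ C, f y = idx y := fun y hy => hne y (h.subset hy)
  refine ⟨f, ?_⟩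
  constructor
  · intro y hy
    rcases Finset.mem_insert.1 hy with rfl | hy
    · simp
    · simp [h.subset hy]
  · intro y hy
    rcases Finset.mem_insert.1 hy with rfl | hy
    · simp [hfp]
    · simp only [hneC y hy]; have := h.lt y hy; omega
  · intro c hc d hd hcd
    rcases Finset.mem_insert.1 hc with hcp | hcC <;>
      rcases Finset.mem_insert.1 hd with hdp | hdC
    · rw [hcp, hdp]
    · rw [hcp, hfp, hneC d hdC] at hcd
      have := h.lt d hdC; omega
    · rw [hdp, hfp, hneC c hcC] at hcd
      have := h.lt c hcC; omega
    · rw [hneC c hcC, hneC d hdC] at hcd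
      exact h.inj c hcC d hdC hcd
  · intro j hj
    rcases Nat.lt_succ_iff_lt_or_eq.1 hj with hj | rfl
    · obtain ⟨c, hc, e⟩ := h.exists_center j hj
      exact ⟨c, Finset.mem_insert_of_mem hc, by simp only [hneC c hc, e]⟩
    · exact ⟨p, by simp, hfp⟩
  · intro j hj
    rcases Nat.lt_succ_iff_lt_or_eq.1 hj with hj | rfl
    · obtain ⟨c, hc, hcC, e⟩ := h.exists_leaf j hj
      refine ⟨c, by simp [hc], ?_, by simp only [hne c hc, e]⟩
      rw [Finset.mem_insert, not_or]
      exact ⟨by rintro rfl; exact hp hc, hcC⟩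
    · exact ⟨x, by simp, by simp [hxC, hxp'], hfx⟩
  · intro y hy hyC
    simp only [Finset.mem_insert, not_or] at hy hyC
    rcases hy with rfl | rfl | hy
    · exact ⟨p, by simp, hxp, by simp only [hfp, hfx]⟩
    · exact absurd rfl hyC.1
    · obtain ⟨d, hd, ha, e⟩ := h.home y hy hyC.2
      exact ⟨d, by simp [hd], ha, by simp only [hneC d hd, hne y hy, e]⟩
  · intro y hy hyC z hz ha
    simp only [Finset.mem_insert, not_or] at hy hyC
    rcases hy with rfl | rfl | hy
    · simp only [Finset.mem_insert] at hz
      rcases hz with rfl | rfl | hz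
      · exact absurd ha G.irrefl
      · exact ⟨by simp, by simp only [hfx, hfp, le_refl]⟩
      · refine ⟨?_, ?_⟩
        · by_contra hzC
          simp only [Finset.mem_insert, not_or] at hzC
          exact hx (hcl z hz hzC.2 _ ha.symm)
        · simp only [hne z hz, hfx]
          exact (h.idx_lt hz).le
    · exact absurd rfl hyC.1
    · have hzT := hcl y hy hyC.2 z ha
      obtain ⟨h1, h2⟩ := h.order y hy hyC.2 z hzT ha
      exact ⟨by simp [h1], by simpa only [hne y hy, hne z hzT] using h2⟩

end StarCover

/-! ### Star covers of trees -/

/-- In a finite tree there are leaf-closed star covers of all sizes, up to an error of one. They are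
built by repeatedly taking, among the vertices not yet covered, one with at most one uncovered
neighbour: with no uncovered neighbour it is a new leaf of an existing star, and otherwise it forms
a new star with its uncovered neighbour as the center. -/
lemma IsTree.exists_starCover [Fintype V] (hG : G.IsTree) (n : ℕ) (hn : n ≤ Fintype.card V)
    (hV : 2 ≤ Fintype.card V) :
    ∃ T C m idx, StarCover G T C m idx ∧ LeafClosed G T C ∧ (T.card = n ∨ T.card + 1 = n) := by
  classical
  induction n with
  | zero => exact ⟨∅, ∅, 0, fun _ => 0, .empty, by simp [LeafClosed], by simp⟩
  | succ n ih =>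
    obtain ⟨T, C, m, idx, h, hcl, hT | hT⟩ := ih (by omega)
    · exact ⟨T, C, m, idx, h, hcl, by simp [hT]⟩
    have hne : ((T : Set V)ᶜ).Nonempty := by
      rw [Set.nonempty_compl]
      intro hu
      have : T = Finset.univ := by exact_mod_cast hu
      rw [this, Finset.card_univ] at hT
      omega
    obtain ⟨x, hx, hx1⟩ := hG.isAcyclic.exists_mem_subsingleton_neighbors (Set.toFinite _) hne
    have hxT : x ∉ T := by simpa using hx
    by_cases hp : ∃ p, p ∉ T ∧ G.Adj x p
    · obtain ⟨p, hp, hxp⟩ := hp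
      obtain ⟨h1, idx', h2⟩ := h.insert_star hcl hxT hp hxp
        (fun y hy hxy => hx1 y (by simpa using hy) p (by simpa using hp) hxy hxp)
      refine ⟨_, _, _, _, h2, h1, Or.inl ?_⟩
      rw [Finset.card_insert_of_notMem (by simp [hxT, hxp.ne]), Finset.card_insert_of_notMem hp]
      omega
    · push Not at hp
      have : Nontrivial V := Fintype.one_lt_card_iff_nontrivial.1 hV
      obtain ⟨y, hxy⟩ := hG.connected.preconnected.exists_adj_of_nontrivial x
      obtain ⟨idx', h2⟩ := h.insert_leaf hxT
        (fun z hz hxz => by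
          by_contra hzC
          exact hxT (hcl z hz hzC x hxz.symm))
        ⟨y, by by_contra hy; exact hp y hy hxy, hxy⟩
      refine ⟨_, _, _, _, h2, ?_, Or.inr ?_⟩
      · intro z hz hzC w hzw
        rcases Finset.mem_insert.1 hz with rfl | hz
        · by_contra hw
          rw [Finset.mem_insert, not_or] at hw
          exact hp w hw.2 hzw
        · exact Finset.mem_insert_of_mem (hcl z hz hzC w hzw)
      · rw [Finset.card_insert_of_notMem hxT]
        omega

end SimpleGraph

/-! ### Sorted enumerations -/

/-- The elements of a finite type can be enumerated so that a given function is monotone. -/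
lemma exists_equiv_monotone {α β : Type*} [Fintype α] [LinearOrder β] (f : α → β) {n : ℕ}
    (hn : Fintype.card α = n) : ∃ e : Fin n ≃ α, Monotone (f ∘ e) := by
  subst hn
  let e₀ := (Fintype.equivFin α).symm
  exact ⟨(Tuple.sort (f ∘ e₀)).trans e₀, Tuple.monotone_sort (f ∘ e₀)⟩

/-- In an enumeration that sorts the elements of `α` by type, elements of the same type are close
to each other. -/
lemma lt_add_of_monotone_of_eq {α β : Type*} [Fintype α] [LinearOrder β] {f : α → β} {n m : ℕ}
    {e : Fin n ≃ α} (he : Monotone (f ∘ e))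
    (hf : ∀ t, (Finset.univ.filter (fun a => f a = t)).card ≤ m)
    {i j : Fin n} (hij : i ≤ j) (h : f (e i) = f (e j)) : (j : ℕ) < i + m := by
  have h1 : (Finset.Icc i j).card ≤ (Finset.univ.filter (fun a => f a = f (e j))).card := by
    refine Finset.card_le_card_of_injOn e (fun l hl => ?_) e.injective.injOn
    obtain ⟨hil, hlj⟩ := Finset.mem_Icc.1 hl
    have h2 : f (e i) ≤ f (e l) := he hil
    have h3 : f (e l) ≤ f (e j) := he hlj
    simpa using le_antisymm h3 (h ▸ h2)
  have h4 := hf (f (e j))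
  rw [Fin.card_Icc] at h1
  have : (i : ℕ) ≤ j := hij
  omega

namespace SimpleGraph.StarCover

variable {V : Type*} {G : SimpleGraph V} {T C : Finset V} {m : ℕ} {idx : V → ℕ}

/-! ### Filling a star cover so that adjacent vertices differ in type -/

/-- The vertices of a cover of a bipartite graph by `m` stars can be enumerated so that adjacent
vertices are at distance at least `m` in the enumeration. The two colour classes are listed one
after the other: the centers of the first class by increasing number of their stars, the leaves of
the stars centered in the second class by decreasing number, the leaves of the stars centered in
the first class by increasing number, and the centers of the second class by decreasing number.
Then each of the `m` stars contributes a vertex to the stretch between two adjacent vertices. -/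
lemma exists_spread_equiv (h : StarCover G T C m idx) (col : V → Bool)
    (hcol : ∀ x y, G.Adj x y → col x ≠ col y) {n : ℕ} (hn : T.card = n) :
    ∃ e : Fin n ≃ T, ∀ i j, i < j → G.Adj (e i) (e j) → (i : ℕ) + m ≤ j := by
  classical
  have cols : ∀ a b : Bool, a ≠ b → (a = true ∧ b = false) ∨ (a = false ∧ b = true) := by decide
  -- sorting by `key` yields the four segments
  obtain ⟨key, keyCt, keyCf, keyLt, keyLf⟩ : ∃ key : V → ℕ,
      (∀ x ∈ C, col x = true → key x = idx x) ∧
      (∀ x ∈ C, col x = false → key x = 4 * m - 1 - idx x) ∧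
      (∀ x ∉ C, col x = true → key x = 2 * m - 1 - idx x) ∧
      (∀ x ∉ C, col x = false → key x = 2 * m + idx x) :=
    ⟨fun x => if x ∈ C then (if col x then idx x else 4 * m - 1 - idx x)
      else (if col x then 2 * m - 1 - idx x else 2 * m + idx x),
      fun x hx h => by simp [hx, h], fun x hx h => by simp [hx, h],
      fun x hx h => by simp [hx, h], fun x hx h => by simp [hx, h]⟩
  have star : ∀ l < m, ∃ c ∈ T, ∃ z ∈ T, idx c = l ∧ idx z = l ∧ c ∈ C ∧
      ((key c = l ∧ key z = 2 * m + l) ∨ (key c = 4 * m - 1 - l ∧ key z = 2 * m - 1 - l)) := by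
    intro l hl
    obtain ⟨z, hz, hzC, hzl⟩ := h.exists_leaf l hl
    obtain ⟨c, hc, hadj, hcl⟩ := h.home z hz hzC
    refine ⟨c, h.subset hc, z, hz, hcl.trans hzl, hzl, hc, ?_⟩
    rcases cols _ _ (hcol _ _ hadj) with ⟨h1, h2⟩ | ⟨h1, h2⟩
    · exact Or.inr ⟨by rw [keyCf c hc h2, hcl, hzl], by rw [keyLt z hzC h1, hzl]⟩
    · exact Or.inl ⟨by rw [keyCt c hc h2, hcl, hzl], by rw [keyLf z hzC h1, hzl]⟩
  obtain ⟨e, he⟩ := exists_equiv_monotone (fun x : T => key x) (n := n) (by simpa using hn)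
  have hlt : ∀ i j, key (e i) < key (e j) → i < j := fun i j hk => by
    by_contra hij
    exact absurd (he (not_lt.1 hij)) (not_le.2 hk)
  refine ⟨e, fun i j hij hadj => ?_⟩
  -- it suffices that each star has a vertex in the stretch from `i` to `j`, one end excluded
  have count : ∀ J : Finset (Fin n), (∀ l < m, ∃ q ∈ J, idx (e q) = l) → m ≤ J.card := by
    intro J hJ
    have : Finset.range m ⊆ J.image (fun q => idx (e q)) := by
      intro l hl
      simpa using hJ l (Finset.mem_range.1 hl)
    calc m = (Finset.range m).card := (Finset.card_range m).symm
      _ ≤ _ := Finset.card_le_card this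
      _ ≤ _ := Finset.card_image_le
  have hxm := h.idx_lt (e i).2
  have hym := h.idx_lt (e j).2
  have hne := hcol _ _ hadj
  have hle : key (e i) ≤ key (e j) := he hij.le
  have hij' : (i : ℕ) < j := hij
  by_cases hx : (e i : V) ∈ C
  · -- the stretch including `i`
    obtain ⟨hcx, hcy⟩ : col (e i) = true ∧ col (e j) = false := by
      refine (cols _ _ hne).resolve_right fun ⟨hcx, hcy⟩ => ?_
      have hkx := keyCf _ hx hcx
      by_cases hy : (e j : V) ∈ C
      · have hky := keyCt _ hy hcy
        omega
      · have hky := keyLt _ hy hcy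
        omega
    have hkx := keyCt _ hx hcx
    suffices m ≤ (Finset.Ico i j).card by rw [Fin.card_Ico] at this; omega
    apply count
    intro l hl
    suffices ∃ z ∈ T, idx z = l ∧ (z = e i ∨ key (e i) < key z) ∧ key z < key (e j) by
      obtain ⟨z, hz, hzl, h1, h2⟩ := this
      have hez : (e (e.symm ⟨z, hz⟩) : V) = z := by simp
      refine ⟨e.symm ⟨z, hz⟩, ?_, by rw [hez, hzl]⟩
      rw [Finset.mem_Ico]
      refine ⟨?_, hlt _ _ (by rwa [hez])⟩
      rcases h1 with h1 | h1
      · exact le_of_eq (e.injective (Subtype.ext (by rw [hez, h1])))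
      · exact (hlt _ _ (by rwa [hez])).le
    obtain ⟨c, hcT, z, hzT, hcl, hzl, hcC, hkey⟩ := star l hl
    by_cases hy : (e j : V) ∈ C
    · have hky := keyCf _ hy hcy
      exact ⟨z, hzT, hzl, Or.inr (by omega), by omega⟩
    · have hord := (h.order _ (e j).2 hy _ (e i).2 hadj.symm).2
      have hky := keyLf _ hy hcy
      rcases hkey with ⟨hk1, hk2⟩ | ⟨hk1, hk2⟩
      · rcases lt_trichotomy l (idx (e i)) with hlt | heq | hgt
        · exact ⟨z, hzT, hzl, Or.inr (by omega), by omega⟩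
        · exact ⟨e i, (e i).2, heq.symm, Or.inl rfl, by omega⟩
        · exact ⟨c, hcT, hcl, Or.inr (by omega), by omega⟩
      · exact ⟨z, hzT, hzl, Or.inr (by omega), by omega⟩
  · -- the stretch including `j`
    obtain ⟨hy, hord⟩ := h.order _ (e i).2 hx _ (e j).2 hadj
    obtain ⟨hcx, hcy⟩ : col (e i) = true ∧ col (e j) = false := by
      refine (cols _ _ hne).resolve_right fun ⟨hcx, hcy⟩ => ?_
      have hkx := keyLf _ hx hcx
      have hky := keyCt _ hy hcy
      omega
    have hkx := keyLt _ hx hcx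
    have hky := keyCf _ hy hcy
    suffices m ≤ (Finset.Ioc i j).card by rw [Fin.card_Ioc] at this; omega
    apply count
    intro l hl
    suffices ∃ z ∈ T, idx z = l ∧ key (e i) < key z ∧ (z = e j ∨ key z < key (e j)) by
      obtain ⟨z, hz, hzl, h1, h2⟩ := this
      have hez : (e (e.symm ⟨z, hz⟩) : V) = z := by simp
      refine ⟨e.symm ⟨z, hz⟩, ?_, by rw [hez, hzl]⟩
      rw [Finset.mem_Ioc]
      refine ⟨hlt _ _ (by rwa [hez]), ?_⟩
      rcases h2 with h2 | h2
      · exact le_of_eq (e.injective (Subtype.ext (by rw [hez, h2])))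
      · exact (hlt _ _ (by rwa [hez])).le
    obtain ⟨c, hcT, z, hzT, hcl, hzl, hcC, hkey⟩ := star l hl
    rcases hkey with ⟨hk1, hk2⟩ | ⟨hk1, hk2⟩
    · exact ⟨z, hzT, hzl, by omega, Or.inr (by omega)⟩
    · rcases lt_trichotomy l (idx (e j)) with hlt | heq | hgt
      · exact ⟨z, hzT, hzl, by omega, Or.inr (by omega)⟩
      · exact ⟨e j, (e j).2, heq.symm, by omega, Or.inl rfl⟩
      · exact ⟨c, hcT, hcl, by omega, Or.inr (by omega)⟩

/-- A set of vertices of a bipartite graph that is covered by `m` stars can be filled with elements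
of types of size at most `m` each so that adjacent vertices receive different types. -/
lemma exists_proper_equiv (h : StarCover G T C m idx) (col : V → Bool)
    (hcol : ∀ x y, G.Adj x y → col x ≠ col y) {α β : Type*} [Fintype α] [LinearOrder β] (f : α → β)
    (hcard : T.card = Fintype.card α)
    (hf : ∀ t, (Finset.univ.filter (fun a => f a = t)).card ≤ m) :
    ∃ φ : α ≃ T, ∀ a b, G.Adj (φ a) (φ b) → f a ≠ f b := by
  obtain ⟨e, he⟩ := h.exists_spread_equiv col hcol hcard
  obtain ⟨g, hg⟩ := exists_equiv_monotone f rfl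
  have key : ∀ i j, i < j → G.Adj (e i) (e j) → f (g i) ≠ f (g j) := fun i j hij hadj heq => by
    have h1 := he i j hij hadj
    have h2 := lt_add_of_monotone_of_eq hg hf hij.le heq
    omega
  refine ⟨g.symm.trans e, fun a b hadj => ?_⟩
  simp only [Equiv.trans_apply] at hadj
  rcases lt_trichotomy (g.symm a) (g.symm b) with hlt | heq | hgt
  · simpa using key _ _ hlt hadj
  · rw [heq] at hadj
    exact absurd hadj G.irrefl
  · simpa using (key _ _ hgt hadj.symm).symm

end SimpleGraph.StarCover

/-! ### Bijections with a prescribed region for one type -/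

/-- If the elements of `α` satisfying `p` are at least as many as those of `D ⊆ T`, then `α` can be
matched with `T` so that only such elements are placed in `D`. -/
lemma exists_equiv_forall_mem {α V : Type*} [Fintype α] {T D : Finset V} (hD : D ⊆ T)
    (hcard : T.card = Fintype.card α) (p : α → Prop) [DecidablePred p]
    (hp : D.card ≤ (Finset.univ.filter p).card) :
    ∃ φ : α ≃ T, ∀ a, (φ a : V) ∈ D → p a := by
  classical
  have e₀ : T ≃ α := Fintype.equivOfCardEq (by simpa using hcard)
  obtain ⟨P, hPp, hP⟩ := Finset.exists_subset_card_eq hp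
  let D' : Finset α := Finset.univ.filter fun a => (e₀.symm a : V) ∈ D
  have hD' : D'.card = D.card := by
    refine Finset.card_bij (fun a _ => (e₀.symm a : V)) (by simp [D']) (fun a _ b _ hab => ?_) ?_
    · exact e₀.symm.injective (Subtype.ext hab)
    · intro x hx
      exact ⟨e₀ ⟨x, hD hx⟩, by simpa [D'] using hx, by simp⟩
  let σ : {a // a ∈ P} ≃ {a // a ∈ D'} := Fintype.equivOfCardEq (by simp [hD', hP])
  refine ⟨(σ.extendSubtype).trans e₀.symm, fun a ha => ?_⟩
  by_contra hpa
  have haP : a ∉ P := fun haP => hpa (Finset.mem_filter.1 (hPp haP)).2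
  exact σ.extendSubtype_not_mem a haP (by simpa [D'] using ha)

/-! ### Utilities and two sufficient conditions for equilibrium -/

namespace JumpGame

variable {R S V : Type*} [Fintype R] [Fintype S] [Fintype V] {k : ℕ}

lemma numType_eq_zero {I : JumpGame R S V k} {A : I.Assignment} {t : Fin k} {v : V}
    (h : ∀ a, I.G.Adj v (A.node a) → I.type a ≠ t) : I.numType A t v = 0 := by
  rw [numType, Set.ncard_eq_zero (Set.toFinite _)]
  ext w
  simp only [Set.mem_ofPred_eq, Set.mem_empty_iff_false, iff_false, not_and, not_exists]
  rintro hw a rfl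
  exact h a hw

lemma numType_pos {I : JumpGame R S V k} {A : I.Assignment} {v : V} (a : R ⊕ S)
    (h : I.G.Adj v (A.node a)) : 0 < I.numType A (I.type a) v := by
  rw [numType, Set.ncard_pos (Set.toFinite _)]
  exact ⟨A.node a, h, a, rfl, rfl⟩

lemma utility_le_one (I : JumpGame R S V k) (A : I.Assignment) (a : R ⊕ S) :
    I.utility A a ≤ 1 := by
  apply div_le_one_of_le₀ _ (Nat.cast_nonneg _)
  exact_mod_cast Finset.sum_le_sum_of_subset (Finset.filter_subset _ _)

lemma utility_nonneg (I : JumpGame R S V k) (A : I.Assignment) (a : R ⊕ S) :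
    0 ≤ I.utility A a := div_nonneg (Nat.cast_nonneg _) (Nat.cast_nonneg _)

lemma utility_eq_zero {I : JumpGame R S V k} {A : I.Assignment} {a : R ⊕ S}
    (h : ∀ b, I.G.Adj (A.node a) (A.node b) → I.type b = I.type a) : I.utility A a = 0 := by
  rw [utility, Finset.sum_eq_zero]
  · simp
  · intro t ht
    have ht : t ≠ I.type a := by simpa using ht
    exact numType_eq_zero fun b hb => (h b hb).symm ▸ ht.symm

lemma utility_eq_one {I : JumpGame R S V k} {A : I.Assignment} {a : R ⊕ S}
    (h : ∀ b, I.G.Adj (A.node a) (A.node b) → I.type b ≠ I.type a)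
    (hex : ∃ b, I.G.Adj (A.node a) (A.node b)) : I.utility A a = 1 := by
  obtain ⟨b, hb⟩ := hex
  have h0 : I.numType A (I.type a) (A.node a) = 0 := numType_eq_zero h
  have hpos : 0 < I.numAgents A (A.node a) :=
    (numType_pos b hb).trans_le (Finset.single_le_sum (f := fun t => I.numType A t (A.node a))
      (fun _ _ => Nat.zero_le _) (Finset.mem_univ (I.type b)))
  have hsum : ∑ t ∈ Finset.univ.filter (fun t : Fin k => t ≠ I.type a),
      I.numType A t (A.node a) = I.numAgents A (A.node a) := by
    refine Finset.sum_subset (Finset.filter_subset _ _) fun t _ ht => ?_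
    have ht : t = I.type a := by simpa using ht
    rw [ht, h0]
  rw [utility, hsum]
  exact div_self (by exact_mod_cast hpos.ne')

/-- Agents of utility `1` have no improving jump. -/
lemma isEquilibrium_of_utility_eq_one {I : JumpGame R S V k} {A : I.Assignment}
    (h : ∀ a, I.utility A a = 1) : I.IsEquilibrium A := fun r A' _ => by
  rw [h]
  exact I.utility_le_one A' _

/-- An assignment is an equilibrium if, for some type `t`, all neighbours of an agent of another
type are occupied by agents of type `t`: the agents of types other than `t` have utility `1`, and
those of type `t` find only agents of type `t` next to the empty nodes. -/
lemma isEquilibrium_of_neighbors {I : JumpGame R S V k} {A : I.Assignment} (t : Fin k)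
    (h : ∀ a, I.type a ≠ t → ∀ w, I.G.Adj (A.node a) w → ∃ b, A.node b = w ∧ I.type b = t)
    (hadj : ∀ v, ∃ w, I.G.Adj v w) : I.IsEquilibrium A := by
  rintro r A' ⟨hempty, hstay⟩
  by_cases hr : I.type (Sum.inl r) = t
  · rw [utility_eq_zero]
    · exact I.utility_nonneg A _
    · intro b hb
      by_cases hbr : b = Sum.inl r
      · rw [hbr]
      · rw [hr]
        by_contra hbt
        rw [hstay b hbr] at hb
        obtain ⟨c, hc, -⟩ := h b hbt _ hb.symm
        exact hempty c hc
  · rw [utility_eq_one (A := A)]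
    · exact I.utility_le_one A' _
    · intro b hb
      obtain ⟨c, hc, hct⟩ := h _ hr _ hb
      obtain rfl := A.injective hc
      exact fun hbr => hr (hbr ▸ hct)
    · obtain ⟨w, hw⟩ := hadj (A.node (Sum.inl r))
      obtain ⟨b, rfl, -⟩ := h _ hr w hw
      exact ⟨b, hw⟩

/-! ### Equilibria from star covers -/

/-- The assignment, in the absence of stubborn agents, that puts the agents on the nodes in `T`
as prescribed by a bijection. -/
def assignmentOfEquiv [IsEmpty S] (I : JumpGame R S V k) {T : Finset V} (φ : R ⊕ S ≃ T) :
    I.Assignment where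
  node a := φ a
  injective := Subtype.val_injective.comp φ.injective
  stubborn s := isEmptyElim s

/-- An equilibrium exists if the agents can fill a set `T` whose members outside `D` have all
their neighbours in `D`, and some type has at least `#D` agents. -/
lemma exists_isEquilibrium_of_subset [IsEmpty S] (I : JumpGame R S V k) {T D : Finset V}
    (hD : D ⊆ T) (hcard : T.card = Fintype.card (R ⊕ S)) (t : Fin k)
    (ht : D.card ≤ (Finset.univ.filter fun a => I.type a = t).card)
    (h : ∀ x ∈ T, x ∉ D → ∀ y, I.G.Adj x y → y ∈ D) (hadj : ∀ v, ∃ w, I.G.Adj v w) :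
    ∃ A : I.Assignment, I.IsEquilibrium A := by
  classical
  obtain ⟨φ, hφ⟩ := exists_equiv_forall_mem hD hcard (fun a => I.type a = t) ht
  refine ⟨I.assignmentOfEquiv φ, isEquilibrium_of_neighbors t (fun a ha w hw => ?_) hadj⟩
  have hwD : w ∈ D := h _ (φ a).2 (fun haD => ha (hφ a haD)) w hw
  refine ⟨φ.symm ⟨w, hD hwD⟩, by simp [assignmentOfEquiv], hφ _ (by simpa using hwD)⟩

/-- An equilibrium exists if the agents can fill a set covered by `m` stars, and no type has more
than `m` agents. -/
lemma exists_isEquilibrium_of_starCover [IsEmpty S] (I : JumpGame R S V k) {T C : Finset V} {m : ℕ}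
    {idx : V → ℕ} (h : I.G.StarCover T C m idx) (hG : I.G.IsAcyclic)
    (hcard : T.card = Fintype.card (R ⊕ S))
    (hm : ∀ t, (Finset.univ.filter fun a => I.type a = t).card ≤ m) :
    ∃ A : I.Assignment, I.IsEquilibrium A := by
  obtain ⟨c⟩ := hG.colorable_two
  obtain ⟨φ, hφ⟩ := h.exists_proper_equiv (fun v => decide (c v = 0))
    (fun x y hxy => by have := c.valid hxy; simp only [ne_eq, decide_eq_decide]; omega)
    I.type hcard hm
  refine ⟨I.assignmentOfEquiv φ, isEquilibrium_of_utility_eq_one fun a => utility_eq_one ?_ ?_⟩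
  · exact fun b hb => (hφ a b hb).symm
  · obtain ⟨y, hy, hay⟩ := h.exists_adj (φ a).2
    exact ⟨φ.symm ⟨y, hy⟩, by simpa [assignmentOfEquiv] using hay⟩

end JumpGame

/-! ### Existence of an equilibrium on trees -/

theorem mainTheorem1 {R S V : Type*} [Fintype R] [Fintype S] [Fintype V] {k : ℕ}
    (I : JumpGame R S V k) (hS : IsEmpty S) (hG : I.G.IsTree)
    (hV : Fintype.card R + 1 < Fintype.card V) :
    ∃ C : I.Assignment, I.IsEquilibrium C := by
  classical
  have hn := I.two_le_agents
  have hlt := I.agents_lt_nodes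
  rw [← Fintype.card_sum] at hn hlt
  have : Nontrivial V := Fintype.one_lt_card_iff_nontrivial.1 (by omega)
  have hadj : ∀ v, ∃ w, I.G.Adj v w := hG.connected.preconnected.exists_adj_of_nontrivial
  -- a type `t` with the largest number of agents
  obtain ⟨t, -, ht⟩ := Finset.univ.exists_max_image
    (fun t : Fin k => (Finset.univ.filter fun a => I.type a = t).card)
    ⟨⟨0, by have := I.two_le_types; omega⟩, Finset.mem_univ _⟩
  have ht := fun s => ht s (Finset.mem_univ s)
  obtain ⟨T, C, m, idx, h, hcl, hT | hT⟩ := hG.exists_starCover _ hlt.le (by omega)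
  · rcases le_total m (Finset.univ.filter fun a => I.type a = t).card with hm | hm
    · refine I.exists_isEquilibrium_of_subset h.subset hT t (h.card_centers.trans_le hm) ?_ hadj
      exact fun x hx hxC y hxy => (h.order x hx hxC y (hcl x hx hxC y hxy) hxy).1
    · exact I.exists_isEquilibrium_of_starCover h hG.isAcyclic hT fun s => (ht s).trans hm
  · -- one agent is left over: its node is an additional center or an additional leaf
    have hT0 : T.Nonempty := Finset.card_pos.1 (by omega)
    obtain ⟨a, ha⟩ := hT0
    obtain ⟨b, hb⟩ : ∃ b, b ∉ T := by
      by_contra! hall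
      have : T.card = Fintype.card V := by rw [Finset.eq_univ_of_forall hall, Finset.card_univ]
      omega
    obtain ⟨y, hy, v, hv, hyv⟩ :=
      hG.connected.preconnected.exists_adj_mem_notMem (A := (T : Set V)) ha (by simpa using hb)
    have hv : v ∉ T := by simpa using hv
    have hcard : (insert v T).card = Fintype.card (R ⊕ S) := by
      rw [Finset.card_insert_of_notMem hv, hT]
    rcases lt_or_ge m (Finset.univ.filter fun a => I.type a = t).card with hm | hm
    · refine I.exists_isEquilibrium_of_subset (Finset.insert_subset_insert v h.subset) hcard t
        ?_ ?_ hadj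
      · rw [Finset.card_insert_of_notMem fun hvC => hv (h.subset hvC), h.card_centers]
        exact hm
      · intro x hx hxC z hxz
        simp only [Finset.mem_insert, not_or] at hx hxC ⊢
        have hx := hx.resolve_left hxC.1
        exact Or.inr (h.order x hx hxC.2 z (hcl x hx hxC.2 z hxz) hxz).1
    · obtain ⟨idx', h'⟩ := h.insert_leaf hv
        (fun z hz hvz => by
          by_contra hzC
          exact hv (hcl z hz hzC v hvz.symm))
        ⟨y, hy, hyv.symm⟩
      exact I.exists_isEquilibrium_of_starCover h' hG.isAcyclic hcard fun s => (ht s).trans hm
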